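/- Let $(R,\mathfrak m,k)$ be a one-dimensional commutative Noetherian Cohen-Macaulay local ring in which every $\mathfrak m$-primary ideal has a principal minimal reduction, i.e. a minimal reduction of the form $(x)$ (this holds, for example, if $k$ is infinite). Assume that $R$ is generically Gorenstein (that is, $R_{\mathfrak p}$ is Gorenstein for every minimal prime $\mathfrak p$ of $R$) and not Gorenstein, and let $\omega_R$ be a canonical ideal of $R$, i.e. an ideal which is a canonical module of $R$; such an ideal is $\mathfrak m$-primary. For an $\mathfrak m$-primary ideal $J$ and a nonzero finitely generated torsion-free $R$-module $M$, let $\mathrm e_R(J,M)=\lim_{n\to\infty}\ell_R(M/J^nM)/n$ be the Hilbert-Samuel multiplicity. Then $M$ is called $J$-Ulrich if $\mathrm e_R(J,M)=\ell_R(M/JM)$, and $M$ is said to have minimal multiplicity with respect to $J$ if $\mathrm e_R(J,M)=\ell_R(JM/J^2M)$; the zero module has neither property. Write $M^*=\operatorname{Hom}_R(M,R)$. Let $I$ be an ideal of $R$ and consider the following conditions: (i) $I$ is $\omega_R$-Ulrich; (ii) $I$ has minimal multiplicity with respect to $\omega_R$; (iii) $I^*$ is $\omega_R$-Ulrich; (iv)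 $I^*$ has minimal multiplicity with respect to $\omega_R$. Then (i) $\Rightarrow$ (ii) $\Rightarrow$ (iii) $\Rightarrow$ (iv). If $I$ is reflexive as an $R$-module (the natural map $I\to I^{**}$ is bijective), then (i), (ii), (iii) and (iv) are equivalent. In particular, $\mathfrak m$ is a reflexive $R$-module, and the four conditions are equivalent for $I=\mathfrak m$. -/

import Mathlib

universe u v

section GorensteinAndCanonical

open CategoryTheory

/-- A finitely generated module `M` over a Noetherian local ring `R` is maximal Cohen–Macaulay if
its depth equals the Krull dimension of `R`, i.e. if there is an `M`-regular sequence in the maximal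
ideal whose length is `dim R` (`IsRegular` includes `M ≠ (r₁, …, r_d) M`, so `M ≠ 0`). -/
def IsMaximalCohenMacaulay (R : Type u) [CommRing R] [IsLocalRing R]
    (M : Type v) [AddCommGroup M] [Module R M] : Prop :=
  Module.Finite R M ∧ ∃ rs : List R,
    (∀ r ∈ rs, r ∈ IsLocalRing.maximalIdeal R) ∧
    RingTheory.Sequence.IsRegular M rs ∧ (rs.length : WithBot ℕ∞) = ringKrullDim R

/-- A Noetherian local ring is Cohen–Macaulay if `depth R = dim R`. -/
def IsCohenMacaulayLocalRing (R : Type u) [CommRing R] [IsLocalRing R] : Prop :=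
  IsMaximalCohenMacaulay R R

/-- The module `M` has finite injective dimension. -/
def HasFiniteInjectiveDimension (R : Type u) [CommRing R]
    (M : Type u) [AddCommGroup M] [Module R M] : Prop :=
  ∃ n : ℕ, HasInjectiveDimensionLE (ModuleCat.of R M) n

/-- A Noetherian local ring is Gorenstein if it has finite injective dimension over itself. -/
def IsGorensteinLocalRing (R : Type u) [CommRing R] [IsLocalRing R] : Prop :=
  HasFiniteInjectiveDimension R R

/-- `R` is generically Gorenstein: its localization at every minimal prime is Gorenstein. -/
def IsGenericallyGorenstein (R : Type u) [CommRing R] : Prop :=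
  ∀ (p : Ideal R) [p.IsPrime], p ∈ minimalPrimes R →
    IsGorensteinLocalRing (Localization.AtPrime p)

/-- A canonical module of a Cohen–Macaulay local ring `R` of dimension `d` with residue field `k`:
a maximal Cohen–Macaulay module `C` of finite injective dimension and of type one, that is,
`dim_k Ext^d_R(k, C) = 1`. This `Ext` is killed by the maximal ideal, so that its dimension over `k`
is its length over `R`. -/
def IsCanonicalModule (R : Type u) [CommRing R] [IsLocalRing R]
    (C : Type u) [AddCommGroup C] [Module R C] : Prop :=
  IsMaximalCohenMacaulay R C ∧ HasFiniteInjectiveDimension R C ∧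
  ∃ d : ℕ, ringKrullDim R = d ∧
    Module.length R (Abelian.Ext (ModuleCat.of R (IsLocalRing.ResidueField R))
      (ModuleCat.of R C) d) = 1

/-- A canonical ideal of `R`: an ideal which is, as an `R`-module, a canonical module of `R`. -/
def IsCanonicalIdeal (R : Type u) [CommRing R] [IsLocalRing R] (ω : Ideal R) : Prop :=
  IsCanonicalModule R ω

end GorensteinAndCanonical

/-- `I` is primary to the maximal ideal of the local ring `R`. -/
def IsMPrimary {R : Type u} [CommRing R] [IsLocalRing R] (I : Ideal R) : Prop :=
  I.radical = IsLocalRing.maximalIdeal R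

/-- `J` is a reduction of `I`: `J ⊆ I` and `I ^ (n + 1) = J I ^ n` for some `n`. -/
def IsReduction {R : Type u} [CommRing R] (J I : Ideal R) : Prop :=
  J ≤ I ∧ ∃ n : ℕ, I ^ (n + 1) = J * I ^ n

/-- `J` is a minimal reduction of `I`: it is minimal, for inclusion, among the reductions of `I`. -/
def IsMinimalReduction {R : Type u} [CommRing R] (J I : Ideal R) : Prop :=
  Minimal (fun J' : Ideal R => IsReduction J' I) J

section Multiplicity

variable {R : Type u} [CommRing R]

/-- `e` is the Hilbert–Samuel multiplicity `e_R(I, M) = lim_n d! ℓ_R(M / I ^ n M) / n ^ d`, where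
`d = dim R`. Used for an ideal `I` primary to the maximal ideal of a Noetherian local ring and a
finitely generated module `M`; then the lengths are finite. -/
def HasMultiplicity (I : Ideal R) (M : Type v) [AddCommGroup M] [Module R M] (e : ℕ) : Prop :=
  ∃ d : ℕ, ringKrullDim R = d ∧
    Filter.Tendsto
      (fun n : ℕ => (d.factorial : ℝ) *
        ((Module.length R (M ⧸ (I ^ n • ⊤ : Submodule R M))).toNat : ℝ) / (n : ℝ) ^ d)
      Filter.atTop (nhds (e : ℝ))

variable [IsLocalRing R]

/-- `M` is an `I`-Ulrich module. Here `I` is primary to the maximal ideal, `M` is a nonzero finitely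
generated torsion-free module, and the condition is `e_R(I, M) = ℓ_R(M / I M)`. -/
def IsUlrich (I : Ideal R) (M : Type v) [AddCommGroup M] [Module R M] : Prop :=
  IsMPrimary I ∧ Nontrivial M ∧ Module.Finite R M ∧ Module.IsTorsionFree R M ∧
  ∃ e : ℕ, HasMultiplicity I M e ∧
    Module.length R (M ⧸ (I • ⊤ : Submodule R M)) = e

/-- `M` has minimal multiplicity with respect to `I`. Here `I` is primary to the maximal ideal, `M`
is a nonzero finitely generated torsion-free module, and the condition is
`e_R(I, M) = ℓ_R(I M / I ^ 2 M)`. -/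
def HasMinimalMultiplicity (I : Ideal R) (M : Type v) [AddCommGroup M] [Module R M] : Prop :=
  IsMPrimary I ∧ Nontrivial M ∧ Module.Finite R M ∧ Module.IsTorsionFree R M ∧
  ∃ e : ℕ, HasMultiplicity I M e ∧
    Module.length R ((I • ⊤ : Submodule R M) ⧸
      (I ^ 2 • ⊤ : Submodule R M).submoduleOf (I • ⊤ : Submodule R M)) = e

end Multiplicity

/-! ### Lengths of quotients of a module. -/

section QuotientLength

variable {R : Type u} [CommRing R] {M : Type v} [AddCommGroup M] [Module R M]

/-! Let `(x)` be a reduction of `ω`; then `x` is a nonzerodivisor and `e(ω, M) = ℓ(M/xM) =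
ℓ(ωM/xωM)` for `M` finitely generated and torsion-free. So `M` is Ulrich iff `ωM = xM`, and has
minimal multiplicity iff `ω²M = xωM` (`isUlrich_iff`, `hasMinimalMultiplicity_iff`). The first
equation implies the second.

The main step is that `ω²M = xωM` forces `ωM* = xM*` (`smul_dual_eq_of_sq_smul_eq`). For `a, w ∈ ω`,
`f ∈ M*` and `m ∈ M`, one has `w · a f(m) = f(awm) ∈ x f(ωM) ⊆ xω`. Since `(xω : ω) = xR`, it
follows that `a f(m) ∈ xR`, so `af` is divisible by `x` in `M*`. Taking `M = I` gives (ii) ⇒ (iii);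
taking `M = I*` and using `I ≅ I**` gives (iv) ⇒ (i).

The equality `(xω : ω) = xR` says that `ω/xω` is faithful over `R/xR`. It is obtained from `Ext¹(k,
ω) ≠ 0` and the vanishing of `Ext²(-, ω)` on modules of finite length
(`mem_span_singleton_of_smul_le`). -/

lemma length_quotient_eq_add {N P : Submodule R M} (h : N ≤ P) :
    Module.length R (M ⧸ N) =
      Module.length R (M ⧸ P) + Module.length R (P ⧸ N.submoduleOf P) := by
  rw [add_comm]
  refine Module.length_eq_add_of_exact (Submodule.mapQ (N.submoduleOf P) N P.subtype fun _ hp => hp)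
    (Submodule.factor h) ?_ (Submodule.factor_surjective h) ?_
  · rw [← LinearMap.ker_eq_bot]
    refine (Submodule.eq_bot_iff _).2 fun z hz => ?_
    obtain ⟨p, rfl⟩ := Submodule.Quotient.mk_surjective _ z
    have hz' : (p : M) ∈ N := (Submodule.Quotient.mk_eq_zero N).1 (LinearMap.mem_ker.1 hz)
    exact (Submodule.Quotient.mk_eq_zero _).2 hz'
  · intro z
    obtain ⟨m, rfl⟩ := Submodule.Quotient.mk_surjective _ z
    constructor
    · intro hm
      have hm' : m ∈ P := by simpa using hm
      exact ⟨Submodule.Quotient.mk ⟨m, hm'⟩, rfl⟩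
    · rintro ⟨w, hw⟩
      obtain ⟨p, rfl⟩ := Submodule.Quotient.mk_surjective _ w
      rw [← hw]
      exact (Submodule.Quotient.mk_eq_zero _).2 p.2

lemma length_quotient_anti {N P : Submodule R M} (h : N ≤ P) :
    Module.length R (M ⧸ P) ≤ Module.length R (M ⧸ N) := by
  rw [length_quotient_eq_add h]
  exact le_self_add

lemma eq_of_length_quotient_eq {N P : Submodule R M} (h : N ≤ P)
    (hfin : Module.length R (M ⧸ P) ≠ ⊤)
    (heq : Module.length R (M ⧸ N) = Module.length R (M ⧸ P)) : N = P := by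
  rw [length_quotient_eq_add h] at heq
  have h0 : Module.length R (P ⧸ N.submoduleOf P) = 0 :=
    ENat.add_right_injective_of_ne_top hfin (heq.trans (add_zero _).symm)
  rw [Module.length_eq_zero_iff, Submodule.Quotient.subsingleton_iff,
    Submodule.submoduleOf_eq_top] at h0
  exact le_antisymm h h0

/-- Additivity of length along `0 → M/P → M/f(P) → M/f(M) → 0`, whose first map is induced by `f`.
-/
lemma length_quotient_map_of_injective {f : M →ₗ[R] M} (hf : Function.Injective f)
    (P : Submodule R M) :
    Module.length R (M ⧸ P.map f) =
      Module.length R (M ⧸ P) + Module.length R (M ⧸ LinearMap.range f) := by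
  refine Module.length_eq_add_of_exact (Submodule.mapQ P (P.map f) f (Submodule.le_comap_map f P))
    (Submodule.factor LinearMap.map_le_range) ?_ (Submodule.factor_surjective _) ?_
  · rw [← LinearMap.ker_eq_bot]
    refine (Submodule.eq_bot_iff _).2 fun z hz => ?_
    obtain ⟨p, rfl⟩ := Submodule.Quotient.mk_surjective _ z
    simpa [hf.eq_iff] using hz
  · intro z
    obtain ⟨m, rfl⟩ := Submodule.Quotient.mk_surjective _ z
    constructor
    · intro hm
      obtain ⟨y, rfl⟩ : m ∈ LinearMap.range f := by simpa using hm
      exact ⟨Submodule.Quotient.mk y, rfl⟩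
    · rintro ⟨w, hw⟩
      obtain ⟨p, rfl⟩ := Submodule.Quotient.mk_surjective _ w
      rw [← hw]
      simp

end QuotientLength

/-! ### Multiplicity, Ulrich and minimal multiplicity through a principal reduction. -/

section Reduction

variable {R : Type u} [CommRing R] {M : Type v} [AddCommGroup M] [Module R M]

lemma span_singleton_smul_eq_map (x : R) (N : Submodule R M) :
    Ideal.span {x} • N = N.map (LinearMap.lsmul R M x) := by
  rw [Submodule.ideal_span_singleton_smul]
  rfl

lemma span_singleton_smul_top_eq_range (x : R) :
    Ideal.span {x} • (⊤ : Submodule R M) = LinearMap.range (LinearMap.lsmul R M x) := by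
  rw [span_singleton_smul_eq_map, Submodule.map_top]

lemma lsmul_injective_of_mem_nonZeroDivisors [Module.IsTorsionFree R M] {x : R}
    (hx : x ∈ nonZeroDivisors R) : Function.Injective (LinearMap.lsmul R M x) :=
  Module.IsTorsionFree.isSMulRegular (isRegular_iff_mem_nonZeroDivisors.2 hx)

lemma length_quotient_span_pow_smul_top [Module.IsTorsionFree R M] {x : R}
    (hx : x ∈ nonZeroDivisors R) (n : ℕ) :
    Module.length R (M ⧸ (Ideal.span {x} ^ n • ⊤ : Submodule R M)) =
      n * Module.length R (M ⧸ (Ideal.span {x} • ⊤ : Submodule R M)) := by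
  induction n with
  | zero =>
    rw [Nat.cast_zero, zero_mul, Module.length_eq_zero_iff, Submodule.Quotient.subsingleton_iff,
      pow_zero, Ideal.one_eq_top, Submodule.top_smul]
  | succ n ih =>
    rw [pow_succ', Submodule.mul_smul, span_singleton_smul_eq_map,
      length_quotient_map_of_injective (lsmul_injective_of_mem_nonZeroDivisors hx), ih,
      ← span_singleton_smul_top_eq_range]
    push_cast
    ring

lemma pow_add_eq_of_pow_succ_eq {I J : Ideal R} {N : ℕ} (h : I ^ (N + 1) = J * I ^ N) (k : ℕ) :
    I ^ (N + k) = J ^ k * I ^ N := by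
  induction k with
  | zero => simp
  | succ k ih => rw [← add_assoc, pow_succ', ih, mul_left_comm, ← pow_succ', h]; ring

/-- The Hilbert–Samuel multiplicity with respect to an ideal with a principal reduction `(x)` is
the length of `M / x M`. -/
lemma hasMultiplicity_iff (hdim : ringKrullDim R = 1) [Module.IsTorsionFree R M] {I : Ideal R}
    {x : R} (hx : x ∈ nonZeroDivisors R) (hI : IsReduction (Ideal.span {x}) I)
    (hfin : Module.length R (M ⧸ (Ideal.span {x} • ⊤ : Submodule R M)) ≠ ⊤) (e : ℕ) :
    HasMultiplicity I M e ↔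
      Module.length R (M ⧸ (Ideal.span {x} • ⊤ : Submodule R M)) = e := by
  obtain ⟨hle, N, hN⟩ := hI
  obtain ⟨a, ha⟩ := ENat.ne_top_iff_exists.1 hfin
  have hup (n : ℕ) :
      Module.length R (M ⧸ (I ^ n • ⊤ : Submodule R M)) ≤ ((n * a : ℕ) : ℕ∞) := by
    refine (length_quotient_anti (Submodule.smul_mono_left (Ideal.pow_right_mono hle n))).trans ?_
    rw [length_quotient_span_pow_smul_top hx, ← ha]
    push_cast
    rfl
  have hlow (n : ℕ) :
      ((n * a : ℕ) : ℕ∞) ≤ Module.length R (M ⧸ (I ^ (N + n) • ⊤ : Submodule R M)) := by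
    have h : I ^ (N + n) ≤ Ideal.span {x} ^ n := by
      rw [pow_add_eq_of_pow_succ_eq hN]
      exact Ideal.mul_le_inf.trans inf_le_left
    refine le_trans (le_of_eq ?_)
      (length_quotient_anti (Submodule.smul_mono_left (N := (⊤ : Submodule R M)) h))
    rw [length_quotient_span_pow_smul_top hx, ← ha]
    push_cast
    rfl
  rw [← ha, Nat.cast_inj]
  set ℓ : ℕ → ℕ := fun n => (Module.length R (M ⧸ (I ^ n • ⊤ : Submodule R M))).toNat
  have hℓup (n : ℕ) : ℓ n ≤ n * a := ENat.toNat_le_of_le_natCast (hup n)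
  have hℓlow (n : ℕ) : n * a ≤ ℓ (N + n) := by
    have := ENat.toNat_le_toNat (hlow n) (ne_top_of_le_ne_top (ENat.natCast_ne_top _) (hup _))
    simpa using this
  -- Squeeze: `a - Na/n ≤ ℓ(n)/n ≤ a`, from `I^(N+k) ⊆ (x)^k` and `(x)^n ⊆ I^n`.
  have hlim : Filter.Tendsto (fun n : ℕ => (ℓ n : ℝ) / n) Filter.atTop (nhds (a : ℝ)) := by
    have h1 : Filter.Tendsto (fun n : ℕ => (a : ℝ) - (N * a : ℝ) / n) Filter.atTop
        (nhds (a : ℝ)) := by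
      simpa using tendsto_const_nhds.sub (tendsto_const_div_atTop_nhds_zero_nat (N * a : ℝ))
    refine tendsto_of_tendsto_of_tendsto_of_le_of_le' h1 tendsto_const_nhds ?_ ?_
    · filter_upwards [Filter.eventually_ge_atTop (N + 1)] with n hn
      obtain ⟨k, rfl⟩ := Nat.exists_eq_add_of_le (Nat.le_of_succ_le hn)
      have hpos : (0 : ℝ) < ((N + k : ℕ) : ℝ) := by exact_mod_cast (by omega : 0 < N + k)
      rw [le_div_iff₀ hpos, sub_mul, div_mul_cancel₀ _ hpos.ne']
      have : ((k * a : ℕ) : ℝ) ≤ ℓ (N + k) := by exact_mod_cast hℓlow k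
      push_cast at this ⊢
      linarith
    · filter_upwards [Filter.eventually_ge_atTop 1] with n hn
      have hpos : (0 : ℝ) < (n : ℝ) := by exact_mod_cast hn
      rw [div_le_iff₀ hpos, mul_comm]
      exact_mod_cast hℓup n
  constructor
  · rintro ⟨d, hd, ht⟩
    obtain rfl : d = 1 := by
      rw [hdim] at hd
      exact_mod_cast hd.symm
    simp only [Nat.factorial_one, Nat.cast_one, one_mul, pow_one] at ht
    exact_mod_cast tendsto_nhds_unique hlim ht
  · rintro rfl
    exact ⟨1, by exact_mod_cast hdim, by simpa using hlim⟩

lemma length_ideal_smul_top_eq_iff {I : Ideal R} {x : R} (hxI : Ideal.span {x} ≤ I)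
    (hfin : Module.length R (M ⧸ (Ideal.span {x} • ⊤ : Submodule R M)) ≠ ⊤) :
    Module.length R (M ⧸ (I • ⊤ : Submodule R M)) =
        Module.length R (M ⧸ (Ideal.span {x} • ⊤ : Submodule R M)) ↔
      (I • ⊤ : Submodule R M) = Ideal.span {x} • ⊤ := by
  have hle : (Ideal.span {x} • ⊤ : Submodule R M) ≤ I • ⊤ := Submodule.smul_mono_left hxI
  refine ⟨fun h => ?_, fun h => by rw [h]⟩
  exact (eq_of_length_quotient_eq hle (ne_top_of_le_ne_top hfin (length_quotient_anti hle))
    h.symm).symm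

/-- Multiplication by `x` gives `ℓ(M/xIM) = ℓ(M/IM) + ℓ(M/xM)`, while `ℓ(M/I²M) = ℓ(M/IM) +
ℓ(IM/I²M)`. As `xIM ⊆ I²M` and all lengths are finite, equal lengths mean equal submodules. -/
lemma length_ideal_smul_top_quotient_eq_iff [Module.IsTorsionFree R M] {I : Ideal R} {x : R}
    (hx : x ∈ nonZeroDivisors R) (hxI : Ideal.span {x} ≤ I)
    (hfin : Module.length R (M ⧸ (Ideal.span {x} • ⊤ : Submodule R M)) ≠ ⊤) :
    Module.length R ((I • ⊤ : Submodule R M) ⧸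
        (I ^ 2 • ⊤ : Submodule R M).submoduleOf (I • ⊤ : Submodule R M)) =
        Module.length R (M ⧸ (Ideal.span {x} • ⊤ : Submodule R M)) ↔
      (I ^ 2 • ⊤ : Submodule R M) = Ideal.span {x} • I • ⊤ := by
  have hle : (Ideal.span {x} • ⊤ : Submodule R M) ≤ I • ⊤ := Submodule.smul_mono_left hxI
  have hfin' := ne_top_of_le_ne_top hfin (length_quotient_anti hle)
  have hsq : (I ^ 2 • ⊤ : Submodule R M) ≤ I • ⊤ :=
    Submodule.smul_mono_left (Ideal.pow_le_self two_ne_zero)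
  have hle2 : (Ideal.span {x} • I • ⊤ : Submodule R M) ≤ I ^ 2 • ⊤ := by
    rw [pow_two, Submodule.mul_smul]
    exact Submodule.smul_mono_left hxI
  have hmap : Module.length R (M ⧸ (Ideal.span {x} • I • ⊤ : Submodule R M)) =
      Module.length R (M ⧸ (I • ⊤ : Submodule R M)) +
        Module.length R (M ⧸ (Ideal.span {x} • ⊤ : Submodule R M)) := by
    rw [span_singleton_smul_eq_map,
      length_quotient_map_of_injective (lsmul_injective_of_mem_nonZeroDivisors hx),
      ← span_singleton_smul_top_eq_range]
  have hadd := length_quotient_eq_add hsq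
  constructor
  · intro h
    rw [h, ← hmap] at hadd
    refine (eq_of_length_quotient_eq hle2 ?_ hadd.symm).symm
    rw [hadd, hmap]
    exact WithTop.add_ne_top.2 ⟨hfin', hfin⟩
  · intro h
    rw [h, hmap, ← h] at hadd
    exact (ENat.add_right_injective_of_ne_top hfin' hadd).symm

variable [IsLocalRing R]

lemma isUlrich_iff (hdim : ringKrullDim R = 1) {I : Ideal R} {x : R}
    (hI : IsMPrimary I) (hx : x ∈ nonZeroDivisors R) (hxI : IsReduction (Ideal.span {x}) I)
    (hfin : Module.length R (M ⧸ (Ideal.span {x} • ⊤ : Submodule R M)) ≠ ⊤) :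
    IsUlrich I M ↔ Nontrivial M ∧ Module.Finite R M ∧ Module.IsTorsionFree R M ∧
      (I • ⊤ : Submodule R M) = Ideal.span {x} • ⊤ := by
  rw [IsUlrich, and_iff_right hI]
  refine and_congr_right fun _ => and_congr_right fun _ => and_congr_right fun _ => ?_
  rw [← length_ideal_smul_top_eq_iff hxI.1 hfin]
  simp only [hasMultiplicity_iff hdim hx hxI hfin]
  obtain ⟨a, ha⟩ := ENat.ne_top_iff_exists.1 hfin
  constructor
  · rintro ⟨e, h1, h2⟩
    rw [h1, h2]
  · intro h
    exact ⟨a, ha.symm, h.trans ha.symm⟩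

lemma hasMinimalMultiplicity_iff (hdim : ringKrullDim R = 1) {I : Ideal R} {x : R}
    (hI : IsMPrimary I) (hx : x ∈ nonZeroDivisors R) (hxI : IsReduction (Ideal.span {x}) I)
    (hfin : Module.length R (M ⧸ (Ideal.span {x} • ⊤ : Submodule R M)) ≠ ⊤) :
    HasMinimalMultiplicity I M ↔ Nontrivial M ∧ Module.Finite R M ∧ Module.IsTorsionFree R M ∧
      (I ^ 2 • ⊤ : Submodule R M) = Ideal.span {x} • I • ⊤ := by
  rw [HasMinimalMultiplicity, and_iff_right hI]
  refine and_congr_right fun _ => and_congr_right fun _ => and_congr_right fun _ => ?_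
  rw [← length_ideal_smul_top_quotient_eq_iff hx hxI.1 hfin]
  simp only [hasMultiplicity_iff hdim hx hxI hfin]
  obtain ⟨a, ha⟩ := ENat.ne_top_iff_exists.1 hfin
  constructor
  · rintro ⟨e, h1, h2⟩
    rw [h1, h2]
  · intro h
    exact ⟨a, ha.symm, h.trans ha.symm⟩

end Reduction

/-! ### Nonzerodivisors in a one-dimensional local ring. -/

section DimensionOne

variable {R : Type u} [CommRing R]

lemma isArtinianRing_quotient_span_singleton [IsNoetherianRing R] (hdim : ringKrullDim R = 1)
    {x : R} (hx : x ∈ nonZeroDivisors R) : IsArtinianRing (R ⧸ Ideal.span {x}) := by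
  have h := ringKrullDim_quotient_succ_le_of_nonZeroDivisor hx
  rw [isArtinianRing_iff_krullDimLE_zero, Ring.krullDimLE_iff]
  rw [hdim] at h
  generalize ringKrullDim (R ⧸ Ideal.span {x}) = d at h
  induction d with
  | bot => exact bot_le
  | coe d =>
    have h' : d + 1 ≤ 1 := by exact_mod_cast h
    have : d ≤ 0 := (ENat.add_le_add_iff_right ENat.one_ne_top).1 (by simpa using h')
    exact_mod_cast this

lemma isFiniteLength_quotient_span_singleton_smul_top [IsNoetherianRing R]
    (hdim : ringKrullDim R = 1) {x : R} (hx : x ∈ nonZeroDivisors R)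
    (M : Type v) [AddCommGroup M] [Module R M] [Module.Finite R M] :
    IsFiniteLength R (M ⧸ (Ideal.span {x} • ⊤ : Submodule R M)) := by
  have := isArtinianRing_quotient_span_singleton hdim hx
  rw [isFiniteLength_iff_isNoetherian_isArtinian]
  refine ⟨inferInstance, ?_⟩
  have : Module.Finite (R ⧸ Ideal.span {x}) (M ⧸ (Ideal.span {x} • ⊤ : Submodule R M)) :=
    Module.Finite.of_restrictScalars_finite R _ _
  have : IsArtinian (R ⧸ Ideal.span {x}) (M ⧸ (Ideal.span {x} • ⊤ : Submodule R M)) :=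
    inferInstance
  exact isArtinian_of_surjective_algebraMap (S := R) (R := R ⧸ Ideal.span {x})
    Ideal.Quotient.mk_surjective

variable [IsLocalRing R]

lemma exists_mem_maximalIdeal_mem_nonZeroDivisors (hdim : ringKrullDim R = 1)
    (hCM : IsCohenMacaulayLocalRing R) :
    ∃ y ∈ IsLocalRing.maximalIdeal R, y ∈ nonZeroDivisors R := by
  obtain ⟨-, rs, hmem, hreg, hlen⟩ := hCM
  rw [hdim] at hlen
  obtain ⟨y, rfl⟩ := List.length_eq_one_iff.1 (by exact_mod_cast hlen : rs.length = 1)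
  refine ⟨y, hmem y (by simp), ?_⟩
  have := ((RingTheory.Sequence.isWeaklyRegular_cons_iff R y []).1 hreg.toIsWeaklyRegular).1
  exact isRegular_iff_mem_nonZeroDivisors.1 ⟨this, IsLeftRegular.right_of_commute (Commute.all y) this⟩

/-- A power of `y` lies in `I`, and a further power in `I^(n+1) = x I^n`; so `x` divides a
nonzerodivisor. -/
lemma mem_nonZeroDivisors_of_isReduction {y : R} (hy : y ∈ IsLocalRing.maximalIdeal R)
    (hy0 : y ∈ nonZeroDivisors R) {I : Ideal R} (hI : IsMPrimary I) {x : R}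
    (hx : IsReduction (Ideal.span {x}) I) : x ∈ nonZeroDivisors R := by
  obtain ⟨-, n, hn⟩ := hx
  obtain ⟨k, hk⟩ : y ∈ I.radical := hI ▸ hy
  have h : (y ^ k) ^ (n + 1) ∈ Ideal.span {x} := by
    have := Ideal.pow_mem_pow hk (n + 1)
    rw [hn] at this
    exact Ideal.mul_le_left this
  obtain ⟨c, hc⟩ := Ideal.mem_span_singleton.1 h
  have : x * c ∈ nonZeroDivisors R := hc ▸ pow_mem (pow_mem hy0 k) (n + 1)
  exact (mul_mem_nonZeroDivisors.1 this).1

/-- Modulo a nonzerodivisor of the maximal ideal, there is a nonzero socle element. -/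
lemma exists_notMem_span_singleton_smul_mem [IsNoetherianRing R] (hdim : ringKrullDim R = 1)
    {y : R} (hy : y ∈ IsLocalRing.maximalIdeal R) (hy0 : y ∈ nonZeroDivisors R) :
    ∃ s : R, s ∉ Ideal.span {y} ∧
      ∀ a ∈ IsLocalRing.maximalIdeal R, a * s ∈ Ideal.span {y} := by
  have := isArtinianRing_quotient_span_singleton hdim hy0
  have hne : Ideal.span {y} ≠ ⊤ := by
    intro h
    rw [Ideal.span_singleton_eq_top] at h
    exact hy h
  have : Nontrivial (R ⧸ Ideal.span {y}) := Ideal.Quotient.nontrivial_iff.2 hne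
  have : IsArtinian R (R ⧸ Ideal.span {y}) :=
    isArtinian_of_surjective_algebraMap (S := R) (R := R ⧸ Ideal.span {y})
      Ideal.Quotient.mk_surjective
  -- A simple submodule of the nonzero Artinian module `R/yR` is killed by the maximal ideal; `s`
  -- lifts a nonzero element of it.
  obtain ⟨S, hS⟩ := IsAtomic.exists_atom (Submodule R (R ⧸ Ideal.span {y}))
  have : IsSimpleModule R S := isSimpleModule_iff_isAtom.2 hS
  obtain ⟨z, hzS, hz⟩ := (Submodule.ne_bot_iff S).1 hS.1
  obtain ⟨s, rfl⟩ := Ideal.Quotient.mk_surjective z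
  refine ⟨s, fun h => hz (Ideal.Quotient.eq_zero_iff_mem.2 h), fun a ha => ?_⟩
  have hmax : (Module.annihilator R S).IsMaximal := IsSimpleModule.annihilator_isMaximal
  have haS : a ∈ Module.annihilator R S := by rwa [IsLocalRing.eq_maximalIdeal hmax]
  have h0 := congrArg Subtype.val (Module.mem_annihilator.1 haS ⟨_, hzS⟩)
  exact Ideal.Quotient.eq_zero_iff_mem.1 h0

end DimensionOne

/-! ### Vanishing of `Ext` and faithfulness of `ω/xω`. -/

section ExtVanishing

open CategoryTheory CategoryTheory.Abelian

variable {R : Type u} [CommRing R] {W : ModuleCat.{u} R}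
  {A B C : Type u} [AddCommGroup A] [Module R A] [AddCommGroup B] [Module R B]
  [AddCommGroup C] [Module R C]

lemma ext_middle_eq_zero {f : A →ₗ[R] B} {g : B →ₗ[R] C} (hf : Function.Injective f)
    (hg : Function.Surjective g) (hfg : Function.Exact f g) {i : ℕ}
    (hA : ∀ e : Ext (ModuleCat.of R A) W i, e = 0) (hC : ∀ e : Ext (ModuleCat.of R C) W i, e = 0)
    (e : Ext (ModuleCat.of R B) W i) : e = 0 := by
  have hS := ModuleCat.shortComplex_shortExact
    (ModuleCat.shortComplexOfCompEqZero f g hfg.linearMap_comp_eq_zero) hfg hf hg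
  obtain ⟨e', rfl⟩ := Ext.contravariant_sequence_exact₂ hS W e (hA _)
  rw [hC e', Ext.comp_zero]

lemma exists_ext_precomp_eq_of_injective {f : A →ₗ[R] B} (hf : Function.Injective f) {i : ℕ}
    (hC : ∀ e : Ext (ModuleCat.of R (B ⧸ LinearMap.range f)) W (i + 1), e = 0)
    (e : Ext (ModuleCat.of R A) W i) :
    ∃ e' : Ext (ModuleCat.of R B) W i,
      (Ext.mk₀ (ModuleCat.ofHom f)).comp e' (zero_add i) = e := by
  have hfg : Function.Exact f (LinearMap.range f).mkQ := LinearMap.exact_map_mkQ_range f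
  have hS := ModuleCat.shortComplex_shortExact
    (ModuleCat.shortComplexOfCompEqZero f _ hfg.linearMap_comp_eq_zero) hfg hf
      (Submodule.mkQ_surjective _)
  exact Ext.contravariant_sequence_exact₁ hS W e (add_comm 1 i) (hC _)

lemma ext_quotient_eq_zero {f : A →ₗ[R] B} {g : B →ₗ[R] C} (hf : Function.Injective f)
    (hg : Function.Surjective g) (hfg : Function.Exact f g) {i : ℕ}
    (hA : ∀ e : Ext (ModuleCat.of R A) W i, e = 0)
    (hB : ∀ e : Ext (ModuleCat.of R B) W (i + 1), e = 0)
    (e : Ext (ModuleCat.of R C) W (i + 1)) : e = 0 := by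
  have hS := ModuleCat.shortComplex_shortExact
    (ModuleCat.shortComplexOfCompEqZero f g hfg.linearMap_comp_eq_zero) hfg hf hg
  obtain ⟨e', rfl⟩ := Ext.contravariant_sequence_exact₃ hS W e (hB _) (add_comm 1 i)
  rw [hA e', Ext.comp_zero]

/-- Precomposition with a surjection is injective on `Ext¹`, if the kernel has no nonzero
homomorphism to the target. -/
lemma ext_one_eq_zero_of_precomp_eq_zero {g : B →ₗ[R] C} (hg : Function.Surjective g)
    (hK : ∀ φ : LinearMap.ker g →ₗ[R] W, φ = 0) (e : Ext (ModuleCat.of R C) W 1)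
    (he : (Ext.mk₀ (ModuleCat.ofHom g)).comp e (zero_add 1) = 0) : e = 0 := by
  obtain ⟨e', rfl⟩ := Ext.contravariant_sequence_exact₃
    (LinearMap.shortExact_shortComplexKer hg) W e he (add_zero 1)
  obtain ⟨φ, rfl⟩ := (Ext.mk₀_bijective _ _).2 e'
  have : φ = 0 := ModuleCat.hom_ext (hK φ.hom)
  rw [this, Ext.mk₀_zero, Ext.comp_zero]

lemma ext_eq_zero_of_linearEquiv (f : A ≃ₗ[R] B) {i : ℕ}
    (hB : ∀ e : Ext (ModuleCat.of R B) W i, e = 0) (e : Ext (ModuleCat.of R A) W i) : e = 0 := by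
  have h : (Ext.mk₀ f.toModuleIso.hom).comp ((Ext.mk₀ f.toModuleIso.inv).comp e (zero_add i))
      (zero_add i) = e := by
    rw [Ext.mk₀_comp_mk₀_assoc, Iso.hom_inv_id, Ext.mk₀_id_comp]
  rw [← h, hB ((Ext.mk₀ f.toModuleIso.inv).comp e _), Ext.comp_zero]

/-- Dévissage along a composition series, whose factors are all isomorphic to the residue field. -/
lemma ext_eq_zero_of_isFiniteLength [IsLocalRing R] {i : ℕ}
    (hk : ∀ e : Ext (ModuleCat.of R (R ⧸ IsLocalRing.maximalIdeal R)) W i, e = 0)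
    (hA : IsFiniteLength R A) (e : Ext (ModuleCat.of R A) W i) : e = 0 := by
  induction hA with
  | @of_subsingleton M _ _ _ =>
    have : Limits.IsZero (ModuleCat.of R M) := ModuleCat.isZero_of_subsingleton _
    exact (Ext.mk₀_id_comp e).symm.trans (by rw [this.eq_of_src (𝟙 _) 0, Ext.mk₀_zero, Ext.zero_comp])
  | @of_simple_quotient M _ _ N hS _ ih =>
    refine ext_middle_eq_zero N.injective_subtype N.mkQ_surjective
      (LinearMap.exact_subtype_mkQ N) (fun e => ih e) ?_ e
    obtain ⟨I, hI, ⟨g⟩⟩ := isSimpleModule_iff_quot_maximal.1 hS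
    obtain rfl := IsLocalRing.eq_maximalIdeal hI
    exact ext_eq_zero_of_linearEquiv g hk

lemma exact_lsmul_mkQ (x : R) :
    Function.Exact (LinearMap.lsmul R R x) (Ideal.span {x}).mkQ := by
  intro a
  simp only [Submodule.mkQ_apply, Submodule.Quotient.mk_eq_zero, Ideal.mem_span_singleton']
  constructor
  · rintro ⟨b, rfl⟩
    exact ⟨b, mul_comm _ _⟩
  · rintro ⟨b, rfl⟩
    exact ⟨b, mul_comm _ _⟩

/-- `0 → R → R → R/xR → 0`, with first map multiplication by `x`, is a free resolution of length
one. -/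
lemma ext_quotient_span_singleton_eq_zero {x : R} (hx : x ∈ nonZeroDivisors R) (i : ℕ)
    (e : Ext (ModuleCat.of R (R ⧸ Ideal.span {x})) W (i + 2)) : e = 0 :=
  ext_quotient_eq_zero (lsmul_injective_of_mem_nonZeroDivisors hx)
    (Submodule.mkQ_surjective _) (exact_lsmul_mkQ x) (fun _ => Ext.eq_zero_of_projective _)
    (fun _ => Ext.eq_zero_of_projective _) e

/-- Multiplication by `s` as an injection `R / (K : s) → R / K`. -/
lemma exists_injective_quotient_colon {J K : Ideal R} {s : R} (h : ∀ a, a ∈ J ↔ a * s ∈ K) :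
    ∃ f : (R ⧸ J) →ₗ[R] (R ⧸ K), Function.Injective f ∧
      ∀ a : R, f (Submodule.Quotient.mk a) = Submodule.Quotient.mk (a * s) := by
  refine ⟨Submodule.mapQ J K (LinearMap.toSpanSingleton R R s) fun a ha => (h a).1 ha, ?_,
    fun a => rfl⟩
  rw [← LinearMap.ker_eq_bot]
  refine (Submodule.eq_bot_iff _).2 fun z hz => ?_
  obtain ⟨a, rfl⟩ := Submodule.Quotient.mk_surjective _ z
  exact (Submodule.Quotient.mk_eq_zero _).2
    ((h a).2 ((Submodule.Quotient.mk_eq_zero K).1 (LinearMap.mem_ker.1 hz)))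

lemma isFiniteLength_quotient_of_mem_nonZeroDivisors [IsNoetherianRing R] (hdim : ringKrullDim R = 1)
    {x : R} (hx : x ∈ nonZeroDivisors R) : IsFiniteLength R (R ⧸ Ideal.span {x}) := by
  have := isFiniteLength_quotient_span_singleton_smul_top hdim hx R
  rwa [smul_eq_mul, Ideal.mul_top] at this

/-- In dimension one, a module of finite injective dimension has injective dimension at most one
against modules of finite length. -/
lemma ext_eq_zero_of_injectiveDimension_le [IsLocalRing R] [IsNoetherianRing R] (hdim : ringKrullDim R = 1)
    {x : R} (hxm : x ∈ IsLocalRing.maximalIdeal R) (hx : x ∈ nonZeroDivisors R) {n : ℕ}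
    (hW : HasInjectiveDimensionLE W n) (hA : IsFiniteLength R A) (i : ℕ)
    (e : Ext (ModuleCat.of R A) W (i + 2)) : e = 0 := by
  -- Descending induction on the degree `i + 2`, starting above the bound `n`; `j` measures how far
  -- below it the degree may be.
  suffices H : ∀ j i : ℕ, n < i + 2 + j → ∀ (A : Type u) [AddCommGroup A] [Module R A],
      IsFiniteLength R A → ∀ e : Ext (ModuleCat.of R A) W (i + 2), e = 0 from
    H n i (by omega) A hA e
  intro j
  induction j with
  | zero =>
    intro i hi A _ _ _ e
    exact Ext.eq_zero_of_hasInjectiveDimensionLT e (n + 1) (by omega)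
  | succ j ih =>
    intro i hi A _ _ hA e
    refine ext_eq_zero_of_isFiniteLength (fun e => ?_) hA e
    obtain ⟨s, hs, hms⟩ := exists_notMem_span_singleton_smul_mem hdim hxm hx
    have hcolon (a : R) : a ∈ IsLocalRing.maximalIdeal R ↔ a * s ∈ Ideal.span {x} := by
      refine ⟨hms a, fun h => ?_⟩
      by_contra ha
      have hu : IsUnit a := by simpa using ha
      exact hs ((Ideal.unit_mul_mem_iff_mem _ hu).1 h)
    -- The socle element embeds `k` in `R/xR`. The cokernel has finite length and no `Ext` one
    -- degree higher, so classes on `k` extend to `R/xR`, where they vanish.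
    obtain ⟨f, hf, -⟩ := exists_injective_quotient_colon hcolon
    obtain ⟨e', rfl⟩ := exists_ext_precomp_eq_of_injective hf
      (ih (i + 1) (by omega) _ ((isFiniteLength_quotient_of_mem_nonZeroDivisors hdim hx).of_surjective
        (Submodule.mkQ_surjective _))) e
    rw [ext_quotient_span_singleton_eq_zero hx i e', Ext.comp_zero]

/-- The resolution of `R/xR` presents `Ext¹(R/xR, W)` as a quotient of `Hom(R, W) = W` in which `xW`
becomes zero, and `rW ⊆ xW`. -/
lemma smul_ext_one_quotient_eq_zero {x r : R} (hx : x ∈ nonZeroDivisors R)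
    (hr : ∀ w : W, ∃ w' : W, r • w = x • w')
    (e : Ext (ModuleCat.of R (R ⧸ Ideal.span {x})) W 1) : r • e = 0 := by
  have hfg := exact_lsmul_mkQ x
  have hS := ModuleCat.shortComplex_shortExact
    (ModuleCat.shortComplexOfCompEqZero _ _ hfg.linearMap_comp_eq_zero) hfg
    (lsmul_injective_of_mem_nonZeroDivisors hx) (Submodule.mkQ_surjective _)
  obtain ⟨e', rfl⟩ := Ext.contravariant_sequence_exact₃ hS W e
    (Ext.eq_zero_of_projective _) (add_zero 1)
  obtain ⟨φ, rfl⟩ := (Ext.mk₀_bijective _ _).2 e'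
  obtain ⟨w', hw'⟩ := hr (φ.hom (1 : R))
  rw [← Ext.comp_smul, ← Ext.mk₀_smul]
  have : r • φ = ModuleCat.ofHom (LinearMap.lsmul R R x) ≫
      ModuleCat.ofHom (LinearMap.toSpanSingleton R W w') := by
    refine ModuleCat.hom_ext (LinearMap.ext_ring ?_)
    change r • φ.hom (1 : R) = (x • (1 : R)) • w'
    rw [hw', smul_eq_mul, mul_one]
  rw [this, ← Ext.mk₀_comp_mk₀]
  exact hS.extClass_comp_assoc _

/-- A torsion-free module of finite injective dimension with `Ext¹(k, W) ≠ 0` over a one-dimensional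
Cohen–Macaulay local ring is faithful modulo every parameter. -/
lemma mem_span_singleton_of_smul_le [IsLocalRing R] [IsNoetherianRing R] (hdim : ringKrullDim R = 1)
    {x r : R} (hxm : x ∈ IsLocalRing.maximalIdeal R) (hx : x ∈ nonZeroDivisors R) {n : ℕ}
    (hW : HasInjectiveDimensionLE W n) [Module.IsTorsionFree R W]
    (hk : Nontrivial (Ext (ModuleCat.of R (R ⧸ IsLocalRing.maximalIdeal R)) W 1))
    (hr : ∀ w : W, ∃ w' : W, r • w = x • w') : r ∈ Ideal.span {x} := by
  by_contra hrx
  -- `J` is the colon ideal `(x) : r`, so multiplication by `r` on `R/xR` factors as a surjection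
  -- `p` onto `R/J` followed by an injection `f`.
  let J : Ideal R := Submodule.comap (LinearMap.toSpanSingleton R R r)  (Ideal.span {x})
  have hJ (a : R) : a ∈ J ↔ a * r ∈ Ideal.span {x} := Iff.rfl
  have hJm : J ≤ IsLocalRing.maximalIdeal R := by
    refine IsLocalRing.le_maximalIdeal fun h => hrx ?_
    simpa using (hJ 1).1 (h ▸ Submodule.mem_top)
  have hxJ : Ideal.span {x} ≤ J := by
    rw [Ideal.span_singleton_le_iff_mem, hJ]
    exact Ideal.mul_mem_right _ _ (Ideal.mem_span_singleton_self x)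
  obtain ⟨f, hf, hfr⟩ := exists_injective_quotient_colon hJ
  let p : (R ⧸ Ideal.span {x}) →ₗ[R] R ⧸ J := Submodule.factor hxJ
  let q : (R ⧸ J) →ₗ[R] R ⧸ IsLocalRing.maximalIdeal R := Submodule.factor hJm
  have hqp : Function.Surjective (q ∘ₗ p) :=
    (Submodule.factor_surjective hJm).comp (Submodule.factor_surjective hxJ)
  have hfp : ModuleCat.ofHom p ≫ ModuleCat.ofHom f =
      r • 𝟙 (ModuleCat.of R (R ⧸ Ideal.span {x})) := by
    refine ModuleCat.hom_ext (LinearMap.ext fun z => ?_)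
    obtain ⟨a, rfl⟩ := Submodule.Quotient.mk_surjective _ z
    change f (Submodule.Quotient.mk a) = r • Submodule.Quotient.mk a
    rw [hfr, mul_comm]
    rfl
  obtain ⟨e, he⟩ := exists_ne (0 : Ext (ModuleCat.of R (R ⧸ IsLocalRing.maximalIdeal R)) W 1)
  -- The pullback of `e` along `q ∘ p` vanishes: `q*e = f*e'` for some `e'`, hence `p*q*e = p*f*e' =
  -- r e' = 0`. This pullback is injective since the kernel of `q ∘ p` is killed by `x` and `W` is
  -- torsion-free, so `e = 0`, a contradiction.
  refine he (ext_one_eq_zero_of_precomp_eq_zero hqp (fun φ => LinearMap.ext fun z => ?_) e ?_)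
  · have hz : x • z = 0 := by
      refine Subtype.ext ?_
      obtain ⟨a, ha⟩ := Submodule.Quotient.mk_surjective _ z.1
      change x • z.1 = 0
      rw [← ha, ← Submodule.Quotient.mk_smul, Submodule.Quotient.mk_eq_zero]
      exact Ideal.mul_mem_right _ _ (Ideal.mem_span_singleton_self x)
    refine lsmul_injective_of_mem_nonZeroDivisors (M := W) hx ?_
    change x • φ z = x • (0 : W)
    rw [← map_smul, hz, map_zero, smul_zero]
  · obtain ⟨e', he'⟩ := exists_ext_precomp_eq_of_injective hf
      (ext_eq_zero_of_injectiveDimension_le hdim hxm hx hW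
        ((isFiniteLength_quotient_of_mem_nonZeroDivisors hdim hx).of_surjective
          (Submodule.mkQ_surjective _)) 0)
      ((Ext.mk₀ (ModuleCat.ofHom q)).comp e (zero_add 1))
    rw [ModuleCat.ofHom_comp, ← Ext.mk₀_comp_mk₀_assoc, ← he', Ext.mk₀_comp_mk₀_assoc, hfp,
      Ext.mk₀_smul, Ext.smul_comp, Ext.mk₀_id_comp]
    exact smul_ext_one_quotient_eq_zero hx hr e'

lemma IsCanonicalIdeal.mem_span_singleton_of_smul_le [IsLocalRing R] [IsNoetherianRing R]
    (hdim : ringKrullDim R = 1) {ω : Ideal R} (hω : IsCanonicalIdeal R ω)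
    {x r : R} (hxm : x ∈ IsLocalRing.maximalIdeal R) (hx : x ∈ nonZeroDivisors R)
    (hr : ∀ w ∈ ω, ∃ w' ∈ ω, r * w = x * w') : r ∈ Ideal.span {x} := by
  obtain ⟨-, ⟨n, hn⟩, d, hd, hlen⟩ := hω
  obtain rfl : d = 1 := by
    rw [hdim] at hd
    exact_mod_cast hd.symm
  refine _root_.mem_span_singleton_of_smul_le (W := ModuleCat.of R ω) hdim hxm hx hn ?_ ?_
  · refine (Module.length_pos_iff (R := R)).1 ?_
    exact hlen ▸ zero_lt_one
  · rintro ⟨w, hw⟩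
    obtain ⟨w', hw', h⟩ := hr w hw
    exact ⟨⟨w', hw'⟩, Subtype.ext h⟩

end ExtVanishing

/-! ### Passing to the dual, and reflexivity of the maximal ideal. -/

section Dual

variable {R : Type u} [CommRing R]

lemma mem_span_singleton_smul_top_iff {M : Type v} [AddCommGroup M] [Module R M] {x : R} {m : M} :
    m ∈ (Ideal.span {x} • ⊤ : Submodule R M) ↔ ∃ m', x • m' = m := by
  rw [span_singleton_smul_top_eq_range]
  rfl

/-- If multiplication by `x⁻¹ ω` preserves `ω M`, then it preserves the dual of `M`, as soon as
`x R` is the colon ideal `x ω : ω`. -/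
lemma smul_dual_eq_of_sq_smul_eq {ω : Ideal R} {x : R} (hxω : Ideal.span {x} ≤ ω)
    (hx : x ∈ nonZeroDivisors R)
    (hcolon : ∀ r : R, (∀ w ∈ ω, ∃ w' ∈ ω, r * w = x * w') → r ∈ Ideal.span {x})
    {M : Type v} [AddCommGroup M] [Module R M]
    (h : (ω ^ 2 • ⊤ : Submodule R M) = Ideal.span {x} • ω • ⊤) :
    (ω • ⊤ : Submodule R (Module.Dual R M)) = Ideal.span {x} • ⊤ := by
  refine le_antisymm (Submodule.smul_le.2 fun a ha f _ => ?_) (Submodule.smul_mono_left hxω)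
  have hdiv (m : M) : ∃ c, x * c = a * f m := by
    suffices h' : a * f m ∈ Ideal.span {x} by
      obtain ⟨c, hc⟩ := Ideal.mem_span_singleton.1 h'
      exact ⟨c, hc.symm⟩
    refine hcolon (a * f m) fun w hw => ?_
    have hmem : (a * w) • m ∈ (ω ^ 2 • ⊤ : Submodule R M) := by
      rw [pow_two]
      exact Submodule.smul_mem_smul (Ideal.mul_mem_mul ha hw) Submodule.mem_top
    rw [h, span_singleton_smul_eq_map] at hmem
    obtain ⟨n, hn, hnm⟩ := hmem
    refine ⟨f n, ?_, ?_⟩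
    · have := Submodule.mem_map_of_mem (f := f) hn
      rw [Submodule.map_smul''] at this
      exact Ideal.mul_le_left this
    · have := congrArg f hnm
      simp only [LinearMap.lsmul_apply, map_smul, smul_eq_mul] at this
      rw [this]
      ring
  choose g hg using hdiv
  have hinj := (isRegular_iff_mem_nonZeroDivisors.2 hx).1
  rw [mem_span_singleton_smul_top_iff]
  refine ⟨{ toFun := g, map_add' := fun m n => hinj ?_, map_smul' := fun r m => hinj ?_ },
    LinearMap.ext hg⟩
  · change x * g (m + n) = x * (g m + g n)
    rw [mul_add, hg, hg, hg, map_add, mul_add]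
  · change x * g (r • m) = x * (r * g m)
    rw [hg, mul_left_comm, hg, map_smul, smul_eq_mul, mul_left_comm]

lemma smul_top_eq_of_linearEquiv {M N : Type*} [AddCommGroup M] [Module R M] [AddCommGroup N]
    [Module R N] (e : M ≃ₗ[R] N) {I J : Ideal R} (h : (I • ⊤ : Submodule R M) = J • ⊤) :
    (I • ⊤ : Submodule R N) = J • ⊤ := by
  have := congrArg (Submodule.map (e : M →ₗ[R] N)) h
  simpa [Submodule.map_smul''] using this

lemma sq_smul_top_eq_of_smul_top_eq {M : Type v} [AddCommGroup M] [Module R M] {I : Ideal R}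
    {x : R} (h : (I • ⊤ : Submodule R M) = Ideal.span {x} • ⊤) :
    (I ^ 2 • ⊤ : Submodule R M) = Ideal.span {x} • I • ⊤ := by
  rw [pow_two, Submodule.mul_smul, h, ← Submodule.mul_smul, mul_comm, Submodule.mul_smul, h]

lemma Ideal.nontrivial_dual {I : Ideal R} (hI : Nontrivial I) : Nontrivial (Module.Dual R I) := by
  obtain ⟨a, ha⟩ := exists_ne (0 : I)
  refine nontrivial_of_ne I.subtype 0 fun h => ha (Subtype.ext ?_)
  exact congrArg (fun φ : Module.Dual R I => φ a) h

end Dual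

/-- The maximal ideal of a one-dimensional Cohen–Macaulay local ring is reflexive. -/
lemma isReflexive_maximalIdeal {R : Type u} [CommRing R] [IsLocalRing R] [IsNoetherianRing R]
    (hdim : ringKrullDim R = 1) {y : R} (hy : y ∈ IsLocalRing.maximalIdeal R)
    (hy0 : y ∈ nonZeroDivisors R) : Module.IsReflexive R (IsLocalRing.maximalIdeal R) := by
  have hinj := (isRegular_iff_mem_nonZeroDivisors.2 hy0).1
  set 𝔪 := IsLocalRing.maximalIdeal R
  refine ⟨⟨fun a b h => Subtype.ext ?_, fun Φ => ?_⟩⟩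
  · exact congrArg (fun Ψ : Module.Dual R (Module.Dual R 𝔪) => Ψ 𝔪.subtype) h
  -- In the dual of `𝔪`, `y f = f(y) ι` with `ι` the inclusion. So `Φ` is determined by `c = Φ(ι)`,
  -- and is evaluation at `c` once `c ∈ 𝔪`.
  have hsmul (f : Module.Dual R 𝔪) : y * Φ f = f ⟨y, hy⟩ * Φ 𝔪.subtype := by
    rw [← smul_eq_mul, ← smul_eq_mul, ← map_smul, ← map_smul]
    congr 1
    refine LinearMap.ext fun a => ?_
    change y * f a = f ⟨y, hy⟩ * a
    rw [← smul_eq_mul, ← map_smul, mul_comm, ← smul_eq_mul, ← map_smul]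
    exact congrArg f (Subtype.ext (mul_comm _ _))
  have hc : Φ 𝔪.subtype ∈ 𝔪 := by
    by_contra hc
    have hu : IsUnit (Φ 𝔪.subtype) := by simpa [𝔪] using hc
    obtain ⟨s, hs, hms⟩ := exists_notMem_span_singleton_smul_mem hdim hy hy0
    have hdiv (a : 𝔪) : ∃ c, y * c = a * s := by
      obtain ⟨c, hc⟩ := Ideal.mem_span_singleton.1 (hms a a.2)
      exact ⟨c, hc.symm⟩
    choose g hg using hdiv
    -- `f` is multiplication by `s/y`, so `f(y) = s` and `y Φ(f) = s c`. If `c` were a unit, `s`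
    -- would lie in `yR`.
    let f : Module.Dual R 𝔪 :=
      { toFun := g
        map_add' := fun a b => hinj (by
          change y * g (a + b) = y * (g a + g b)
          rw [mul_add, hg, hg, hg, ← add_mul]
          rfl)
        map_smul' := fun r a => hinj (by
          change y * g (r • a) = y * (r * g a)
          rw [hg, mul_left_comm, hg, ← mul_assoc]
          rfl) }
    have hfy : f ⟨y, hy⟩ = s := hinj (hg ⟨y, hy⟩)
    refine hs ((Ideal.mul_unit_mem_iff_mem _ hu).1 ?_)
    rw [← hfy, ← hsmul f]
    exact Ideal.mul_mem_right _ _ (Ideal.mem_span_singleton_self y)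
  refine ⟨⟨_, hc⟩, LinearMap.ext fun f => hinj ?_⟩
  change y * f ⟨_, hc⟩ = y * Φ f
  rw [hsmul, mul_comm (f _), ← smul_eq_mul, ← map_smul, ← smul_eq_mul, ← map_smul]
  exact congrArg f (Subtype.ext (mul_comm _ _))

/-! ### The implications and the theorem. -/

section Ulrich

variable {R : Type u} [CommRing R] [IsLocalRing R] [IsNoetherianRing R]

lemma ulrich_implications (hdim : ringKrullDim R = 1)
    {ω : Ideal R} (hω : IsCanonicalIdeal R ω) {x : R} (hωm : IsMPrimary ω)
    (hx : x ∈ nonZeroDivisors R) (hxω : IsReduction (Ideal.span {x}) ω) (I : Ideal R) :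
    (IsUlrich ω I → HasMinimalMultiplicity ω I) ∧
    (HasMinimalMultiplicity ω I → IsUlrich ω (Module.Dual R I)) ∧
    (IsUlrich ω (Module.Dual R I) → HasMinimalMultiplicity ω (Module.Dual R I)) ∧
    (Module.IsReflexive R I → HasMinimalMultiplicity ω (Module.Dual R I) → IsUlrich ω I) := by
  have hfin (M : Type u) [AddCommGroup M] [Module R M] [Module.Finite R M] :
      Module.length R (M ⧸ (Ideal.span {x} • ⊤ : Submodule R M)) ≠ ⊤ :=
    Module.length_ne_top_iff.2 (isFiniteLength_quotient_span_singleton_smul_top hdim hx M)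
  have hxm : x ∈ IsLocalRing.maximalIdeal R := by
    rw [← hωm]
    exact Ideal.le_radical (hxω.1 (Ideal.mem_span_singleton_self x))
  have hcolon := fun r => hω.mem_span_singleton_of_smul_le hdim hxm hx (r := r)
  have hU (M : Type u) [AddCommGroup M] [Module R M] [Module.Finite R M] :=
    isUlrich_iff hdim hωm hx hxω (hfin M)
  have hMM (M : Type u) [AddCommGroup M] [Module R M] [Module.Finite R M] :=
    hasMinimalMultiplicity_iff hdim hωm hx hxω (hfin M)
  rw [hU, hMM, hU, hMM]
  refine ⟨?_, ?_, ?_, ?_⟩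
  · rintro ⟨h1, h2, h3, h4⟩
    exact ⟨h1, h2, h3, sq_smul_top_eq_of_smul_top_eq h4⟩
  · rintro ⟨h1, h2, h3, h4⟩
    exact ⟨Ideal.nontrivial_dual h1, inferInstance, inferInstance,
      smul_dual_eq_of_sq_smul_eq hxω.1 hx hcolon h4⟩
  · rintro ⟨h1, h2, h3, h4⟩
    exact ⟨h1, h2, h3, sq_smul_top_eq_of_smul_top_eq h4⟩
  · rintro hr ⟨h1, -, -, h4⟩
    -- The dual step applied to `I*` gives `ωI** = xI**`, carried back to `I` by biduality.
    refine ⟨?_, inferInstance, inferInstance,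
      smul_top_eq_of_linearEquiv (Module.evalEquiv R I).symm
        (smul_dual_eq_of_sq_smul_eq hxω.1 hx hcolon h4)⟩
    by_contra hI
    rw [not_nontrivial_iff_subsingleton] at hI
    exact not_subsingleton (Module.Dual R I) (inferInstanceAs (Subsingleton (I →ₗ[R] R)))

end Ulrich

theorem mainTheorem4 (R : Type u) [CommRing R] [IsLocalRing R] [IsNoetherianRing R]
    (hdim : ringKrullDim R = 1) (hCM : IsCohenMacaulayLocalRing R)
    (hred : ∀ I : Ideal R, IsMPrimary I →
      ∃ x : R, IsMinimalReduction (Ideal.span {x}) I)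
    (hgen : IsGenericallyGorenstein R) (hnG : ¬ IsGorensteinLocalRing R)
    (ω : Ideal R) (hω : IsCanonicalIdeal R ω) :
    (∀ I : Ideal R,
      (IsUlrich ω I → HasMinimalMultiplicity ω I) ∧
      (HasMinimalMultiplicity ω I → IsUlrich ω (Module.Dual R I)) ∧
      (IsUlrich ω (Module.Dual R I) → HasMinimalMultiplicity ω (Module.Dual R I)) ∧
      (Module.IsReflexive R I →
        List.TFAE [IsUlrich ω I, HasMinimalMultiplicity ω I,
          IsUlrich ω (Module.Dual R I), HasMinimalMultiplicity ω (Module.Dual R I)])) ∧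
    Module.IsReflexive R (IsLocalRing.maximalIdeal R) ∧
    List.TFAE [IsUlrich ω (IsLocalRing.maximalIdeal R),
      HasMinimalMultiplicity ω (IsLocalRing.maximalIdeal R),
      IsUlrich ω (Module.Dual R (IsLocalRing.maximalIdeal R)),
      HasMinimalMultiplicity ω (Module.Dual R (IsLocalRing.maximalIdeal R))] := by
  obtain ⟨y, hy, hy0⟩ := exists_mem_maximalIdeal_mem_nonZeroDivisors hdim hCM
  have key (I : Ideal R) :
      (IsUlrich ω I → HasMinimalMultiplicity ω I) ∧
      (HasMinimalMultiplicity ω I → IsUlrich ω (Module.Dual R I)) ∧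
      (IsUlrich ω (Module.Dual R I) → HasMinimalMultiplicity ω (Module.Dual R I)) ∧
      (Module.IsReflexive R I → HasMinimalMultiplicity ω (Module.Dual R I) → IsUlrich ω I) := by
    -- Both properties include that `ω` is primary to the maximal ideal, so every premise is false
    -- otherwise.
    by_cases hωm : IsMPrimary ω
    · obtain ⟨x, hx⟩ := hred ω hωm
      exact ulrich_implications hdim hω hωm
        (mem_nonZeroDivisors_of_isReduction hy hy0 hωm hx.prop) hx.prop I
    · exact ⟨fun h => absurd h.1 hωm, fun h => absurd h.1 hωm, fun h => absurd h.1 hωm,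
        fun _ h => absurd h.1 hωm⟩
  have tfae (I : Ideal R) (hI : Module.IsReflexive R I) :
      List.TFAE [IsUlrich ω I, HasMinimalMultiplicity ω I,
        IsUlrich ω (Module.Dual R I), HasMinimalMultiplicity ω (Module.Dual R I)] := by
    obtain ⟨h12, h23, h34, h41⟩ := key I
    tfae_have 1 → 2 := h12
    tfae_have 2 → 3 := h23
    tfae_have 3 → 4 := h34
    tfae_have 4 → 1 := h41 hI
    tfae_finish
  have hm := isReflexive_maximalIdeal hdim hy hy0
  exact ⟨fun I => ⟨(key I).1, (key I).2.1, (key I).2.2.1, tfae I⟩, hm, tfae _ hm⟩
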